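/- Let $d_A,d_B\ge 2$, $d=\min(d_A,d_B)$, and let $\rho$ be a state (a positive semidefinite matrix of trace $1$) on $\mathbb{C}^{d_A}\otimes\mathbb{C}^{d_B}$, with reduced states $\rho_A=\operatorname{Tr}_B\rho$ and $\rho_B=\operatorname{Tr}_A\rho$. Let $\mu\in\mathbb{R}^n$ and $\nu\in\mathbb{R}^m$ be arbitrary real column vectors with Euclidean norms $|\mu|,|\nu|$, where $n,m$ are positive integers. Let $\operatorname{Vec}$ be column-stacking vectorization. Write $\rho$ as a $d_A\times d_A$ block matrix with $d_B\times d_B$ blocks $\rho_{i,j}$, and let $\mathcal{R}(\rho)$ be the $d_A^2\times d_B^2$ realigned matrix with rows $\operatorname{Vec}(\rho_{1,1})^T,\dots,\operatorname{Vec}(\rho_{d_A,1})^T,\dots,\operatorname{Vec}(\rho_{1,d_A})^T,\dots,\operatorname{Vec}(\rho_{d_A,d_A})^T$. Put $$\mathcal{Q}_{\mu,\nu}(\rho)=\begin{pmatrix}\mu\nu^T & \mu\operatorname{Vec}(\rho_B)^T\\ \operatorname{Vec}(\rho_A)\nu^T & \mathcal{R}(\rho)\end{pmatrix},\qquad \|X\|_{\mathrm{Tr}}=\operatorname{Tr}\sqrt{X^\dagger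 X}.$$ For a unit vector $|\varphi\rangle\in\mathbb{C}^{d_A}\otimes\mathbb{C}^{d_B}$ let $$\mathcal{N}(|\varphi\rangle)=\frac{\|(|\varphi\rangle\langle\varphi|)^{T_B}\|_{\mathrm{Tr}}-1}{d-1},$$ where $T_B$ denotes partial transposition on the second factor, and let the convex-roof extended negativity of $\rho$ be $$\mathcal{N}(\rho)=\inf_{\{p_i,|\varphi_i\rangle\}}\sum_i p_i\,\mathcal{N}(|\varphi_i\rangle),$$ over all finite decompositions $\rho=\sum_i p_i|\varphi_i\rangle\langle\varphi_i|$ with $p_i\ge 0$, $\sum_i p_i=1$ and unit vectors $|\varphi_i\rangle$. Then $$\mathcal{N}(\rho)\ \ge\ \frac{\|\mathcal{Q}_{\mu,\nu}(\rho)\|_{\mathrm{Tr}}-\sqrt{(|\mu|^2+1)(|\nu|^2+1)}}{d-1}.$$ -/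

import Mathlib

open scoped Matrix MatrixOrder ComplexOrder

namespace Realign

/-- The trace norm `Tr √(A† A)` of a rectangular complex matrix. The square root is the positive
semidefinite one; its trace is a non-negative real number, read off by the real part. -/
noncomputable def traceNorm {m n : Type*} [Fintype m] [Fintype n] [DecidableEq n]
    (A : Matrix m n ℂ) : ℝ :=
  (Matrix.trace (CFC.sqrt (Aᴴ * A))).re

section Bipartite

variable {dA dB : ℕ}

/-- Operators on `ℂ^dA ⊗ ℂ^dB`, in the product basis; the row of `|i_A k_B⟩` is `(i, k)`. -/
abbrev BipartiteMatrix (dA dB : ℕ) : Type :=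
  Matrix (Fin dA × Fin dB) (Fin dA × Fin dB) ℂ

/-- Vectors of `ℂ^dA ⊗ ℂ^dB`, in the product basis. -/
abbrev BipartiteVector (dA dB : ℕ) : Type :=
  EuclideanSpace ℂ (Fin dA × Fin dB)

/-- A state (density matrix): positive semidefinite of trace one. -/
def IsState (ρ : BipartiteMatrix dA dB) : Prop :=
  ρ.PosSemidef ∧ ρ.trace = 1

/-- The `(i, j)` sub-block, of size `dB × dB`. -/
def block (Z : BipartiteMatrix dA dB) (i j : Fin dA) : Matrix (Fin dB) (Fin dB) ℂ :=
  Matrix.of fun k l => Z (i, k) (j, l)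

/-- The reduced state of system `A`: the partial trace over `B`. -/
def reducedA (ρ : BipartiteMatrix dA dB) : Matrix (Fin dA) (Fin dA) ℂ :=
  Matrix.of fun i j => ∑ k, ρ (i, k) (j, k)

/-- The reduced state of system `B`: the partial trace over `A`. -/
def reducedB (ρ : BipartiteMatrix dA dB) : Matrix (Fin dB) (Fin dB) ℂ :=
  Matrix.of fun k l => ∑ i, ρ (i, k) (i, l)

/-- The transpose on the second factor. -/
def partialTransposeB (ρ : BipartiteMatrix dA dB) : BipartiteMatrix dA dB :=
  Matrix.of fun x y => ρ (x.1, y.2) (y.1, x.2)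

/-- The realigned matrix. Its rows are the transposed column-stacking vectorizations of the
sub-blocks. Like an entry of `Matrix.vec`, a row is labelled `(j, i)` (column first), so the rows
come in the order `Z₁₁, Z₂₁, …, Z₁₂, Z₂₂, …`. -/
def realign (Z : BipartiteMatrix dA dB) : Matrix (Fin dA × Fin dA) (Fin dB × Fin dB) ℂ :=
  Matrix.of fun p => (block Z p.2 p.1).vec

/-- A real vector regarded as a complex one. -/
noncomputable def complexify {n : ℕ} (μ : EuclideanSpace ℝ (Fin n)) : Fin n → ℂ :=
  fun i => ((μ i : ℝ) : ℂ)

/-- The block matrix with rows `(μ νᵀ, μ Vec(ρ_B)ᵀ)` and `(Vec(ρ_A) νᵀ, R(ρ))`. -/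
noncomputable def Q {n m : ℕ} (μ : EuclideanSpace ℝ (Fin n)) (ν : EuclideanSpace ℝ (Fin m))
    (ρ : BipartiteMatrix dA dB) :
    Matrix (Fin n ⊕ Fin dA × Fin dA) (Fin m ⊕ Fin dB × Fin dB) ℂ :=
  Matrix.fromBlocks
    (Matrix.vecMulVec (complexify μ) (complexify ν))
    (Matrix.vecMulVec (complexify μ) (reducedB ρ).vec)
    (Matrix.vecMulVec (reducedA ρ).vec (complexify ν))
    (realign ρ)

/-- The projector `|φ⟩⟨φ|`. -/
noncomputable def projector (φ : BipartiteVector dA dB) : BipartiteMatrix dA dB :=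
  Matrix.vecMulVec (fun x => φ x) (fun x => star (φ x))

/-- The negativity `(‖(|φ⟩⟨φ|)^{T_B}‖_Tr - 1) / (d - 1)`, `d = min dA dB`, of a pure state. -/
noncomputable def pureNegativity (φ : BipartiteVector dA dB) : ℝ :=
  (traceNorm (partialTransposeB (projector φ)) - 1) / (((min dA dB : ℕ) : ℝ) - 1)

/-- `{p i, φ i}` is a decomposition of `ρ` as a convex combination of pure states. -/
def IsPureDecomposition {k : ℕ} (p : Fin k → ℝ) (φ : Fin k → BipartiteVector dA dB)
    (ρ : BipartiteMatrix dA dB) : Prop :=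
  (∀ i, 0 ≤ p i) ∧ ∑ i, p i = 1 ∧ (∀ i, ‖φ i‖ = 1) ∧ ρ = ∑ i, (p i : ℂ) • projector (φ i)

/-- The convex-roof extended negativity: the infimum of the average negativity over all
finite pure-state decompositions. For a state it is an infimum over a nonempty set (spectral
decomposition), so wherever the minimum is attained the two agree. -/
noncomputable def cren (ρ : BipartiteMatrix dA dB) : ℝ :=
  sInf {x : ℝ | ∃ (k : ℕ) (p : Fin k → ℝ) (φ : Fin k → BipartiteVector dA dB),
    IsPureDecomposition p φ ρ ∧ x = ∑ i, p i * pureNegativity (φ i)}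

end Bipartite

end Realign

/-! `Q` is affine in the state: its constant block survives averaging because the weights sum to
one. The trace norm is convex. So, for every pure decomposition, the claim reduces to the pure-state
bound `traceNorm_Q_projector_le`.

For a pure state with Schmidt coefficients `s j`, the partial transpose has singular values `s j * s
l`, hence trace norm `(∑ s j) ^ 2`. In the same basis `Q` is a sum over pairs `(j, l)` of rank-one
matrices with weight `s j * s l`. Off-diagonal pairs involve unit vectors; diagonal pairs also carry
`μ` and `ν`, so their norms multiply to `c = √((‖μ‖² + 1)(‖ν‖² + 1))`. As `∑ s j ^ 2 = 1`, the
triangle inequality gives `(∑ s j) ^ 2 - 1 + c`. -/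

namespace Realign

open Matrix
open scoped Kronecker

/-! ### Singular values and convexity of the trace norm. -/

section TraceNorm

variable {m n ι : Type*} [Fintype m] [Fintype ι]

/-- The Hermitian square of a matrix given by a singular value decomposition. -/
lemma conjTranspose_mul_self_of_svd [DecidableEq ι] {U : Matrix m ι ℂ} {V : Matrix n ι ℂ}
    (hU : Uᴴ * U = 1) (s : ι → ℝ) :
    (U * diagonal (fun j => (s j : ℂ)) * Vᴴ)ᴴ * (U * diagonal (fun j => (s j : ℂ)) * Vᴴ) =
      V * (diagonal (fun j => (s j : ℂ)) * diagonal (fun j => (s j : ℂ))) * Vᴴ := by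
  have hD : (diagonal (fun j => (s j : ℂ)))ᴴ = diagonal (fun j => (s j : ℂ)) := by
    rw [diagonal_conjTranspose]
    congr 1
    ext j
    simp
  rw [conjTranspose_mul, conjTranspose_mul, hD, conjTranspose_conjTranspose]
  calc V * (diagonal (fun j => (s j : ℂ)) * Uᴴ) * (U * diagonal (fun j => (s j : ℂ)) * Vᴴ)
      = V * (diagonal (fun j => (s j : ℂ)) * (Uᴴ * U) * diagonal (fun j => (s j : ℂ))) * Vᴴ := by
        simp only [Matrix.mul_assoc]
    _ = _ := by rw [hU, Matrix.mul_one]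

variable [Fintype n]

/-- The trace norm is the sum of the singular values. -/
lemma traceNorm_svd [DecidableEq n] [DecidableEq ι] {U : Matrix m ι ℂ} {V : Matrix n ι ℂ}
    (hU : Uᴴ * U = 1) (hV : Vᴴ * V = 1) {s : ι → ℝ} (hs : ∀ j, 0 ≤ s j) :
    traceNorm (U * diagonal (fun j => (s j : ℂ)) * Vᴴ) = ∑ j, s j := by
  have hpos : (V * diagonal (fun j => (s j : ℂ)) * Vᴴ).PosSemidef := by
    refine PosSemidef.mul_mul_conjTranspose_same (PosSemidef.diagonal ?_) V
    intro j
    simpa using hs j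
  have hsq : CFC.sqrt ((U * diagonal (fun j => (s j : ℂ)) * Vᴴ)ᴴ *
      (U * diagonal (fun j => (s j : ℂ)) * Vᴴ)) = V * diagonal (fun j => (s j : ℂ)) * Vᴴ := by
    refine CFC.sqrt_unique ?_ hpos.nonneg
    rw [conjTranspose_mul_self_of_svd hU]
    calc V * diagonal (fun j => (s j : ℂ)) * Vᴴ * (V * diagonal (fun j => (s j : ℂ)) * Vᴴ)
        = V * (diagonal (fun j => (s j : ℂ)) * (Vᴴ * V) * diagonal (fun j => (s j : ℂ))) * Vᴴ := by
          simp only [Matrix.mul_assoc]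
      _ = _ := by rw [hV, Matrix.mul_one]
  rw [traceNorm, hsq, Matrix.trace_mul_comm, ← Matrix.mul_assoc, hV, Matrix.one_mul, trace_diagonal]
  simp

/-- The singular value decomposition of a rectangular complex matrix. -/
lemma exists_svd [DecidableEq n] (A : Matrix m n ℂ) :
    ∃ (S : Set n) (_ : Fintype S) (s : S → ℝ) (U : Matrix m S ℂ) (V : Matrix n S ℂ),
      (∀ j, 0 < s j) ∧ Uᴴ * U = 1 ∧ Vᴴ * V = 1 ∧
        A = U * diagonal (fun j => (s j : ℂ)) * Vᴴ := by
  classical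
  have hA := posSemidef_conjTranspose_mul_self A
  set l := hA.1.eigenvalues
  set E : Matrix n n ℂ := (hA.1.eigenvectorUnitary : Matrix n n ℂ)
  have hEE : Eᴴ * E = 1 := Unitary.coe_star_mul_self hA.1.eigenvectorUnitary
  have hspec : Aᴴ * A = E * diagonal (fun j => (l j : ℂ)) * Eᴴ := by
    have := hA.1.spectral_theorem
    rw [Unitary.conjStarAlgAut_apply] at this
    exact this
  -- Discarding the kernel of `Aᴴ * A` makes all singular values positive, so that their diagonal
  -- matrix is invertible.
  let S : Set n := {j | l j ≠ 0}
  let V : Matrix n S ℂ := E.submatrix id Subtype.val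
  let s : S → ℝ := fun j => √(l j)
  have hs : ∀ j, 0 < s j := fun j =>
    Real.sqrt_pos.2 (lt_of_le_of_ne (hA.eigenvalues_nonneg j) (Ne.symm j.2))
  have hV : Vᴴ * V = 1 := by
    ext a b
    have := congrFun (congrFun hEE a.1) b.1
    simpa [V, Matrix.mul_apply, Matrix.one_apply, Subtype.ext_iff] using this
  have hsV : Aᴴ * A = V * diagonal (fun j => ((s j : ℂ) * s j)) * Vᴴ := by
    rw [hspec]
    ext a b
    rw [Matrix.mul_apply, Matrix.mul_apply]
    simp only [mul_diagonal, conjTranspose_apply]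
    have h1 : ∀ j : S, V a j * ((s j : ℂ) * s j) * star (V b j) =
        (fun j : n => E a j * (l j : ℂ) * star (E b j)) j := by
      intro j
      have : ((s j : ℂ) * s j) = l j := by
        rw [← Complex.ofReal_mul, Real.mul_self_sqrt (hA.eigenvalues_nonneg j)]
      simp only [this]
      rfl
    rw [Finset.sum_congr rfl fun j _ => h1 j]
    rw [← Finset.sum_subtype (Finset.univ.filter fun j => l j ≠ 0) (by simp [S])
      (fun j : n => E a j * (l j : ℂ) * star (E b j)), Finset.sum_filter_of_ne]
    intro j _ hj h0
    simp [h0] at hj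
  let D : Matrix S S ℂ := diagonal (fun j => (s j : ℂ))
  let D' : Matrix S S ℂ := diagonal (fun j => ((s j)⁻¹ : ℂ))
  have hne : ∀ j, (s j : ℂ) ≠ 0 := fun j => by exact_mod_cast (hs j).ne'
  have hDD' : D' * D = 1 := by
    simp [D, D', diagonal_mul_diagonal, hne]
  have hD'h : D'ᴴ = D' := by
    simp only [D', diagonal_conjTranspose]
    congr 1
    ext j
    simp
  -- `A` and `Aᴴ * A` have the same kernel, so `A` vanishes off the span of the columns of `V`.
  have hAV : A * (1 - V * Vᴴ) = 0 := by
    rw [← conjTranspose_mul_self_mul_eq_zero, hsV, Matrix.mul_sub, Matrix.mul_one, sub_eq_zero]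
    simp only [Matrix.mul_assoc]
    rw [← Matrix.mul_assoc Vᴴ V, hV, Matrix.one_mul]
  refine ⟨S, inferInstance, s, A * V * D', V, hs, ?_, hV, ?_⟩
  · have : (A * V * D')ᴴ * (A * V * D') = D' * (Vᴴ * (Aᴴ * A) * V) * D' := by
      simp only [conjTranspose_mul, hD'h, Matrix.mul_assoc]
    rw [this, hsV]
    have : Vᴴ * (V * diagonal (fun j => ((s j : ℂ) * s j)) * Vᴴ) * V =
        (Vᴴ * V) * diagonal (fun j => ((s j : ℂ) * s j)) * (Vᴴ * V) := by
      simp only [Matrix.mul_assoc]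
    rw [this, hV]
    simp [D', diagonal_mul_diagonal, hne]
  · change A = A * V * D' * D * Vᴴ
    rw [Matrix.mul_assoc _ D' D, hDD', Matrix.mul_one]
    rw [Matrix.mul_sub, Matrix.mul_one, sub_eq_zero] at hAV
    rw [Matrix.mul_assoc]
    exact hAV

lemma norm_toLp_sq (z : m → ℂ) : ((‖WithLp.toLp 2 z‖ ^ 2 : ℝ) : ℂ) = star z ⬝ᵥ z := by
  rw [EuclideanSpace.norm_sq_eq]
  simp [dotProduct, Complex.conj_mul']

/-- Bessel's inequality for the columns of an isometry. -/
lemma norm_conjTranspose_mulVec_le [DecidableEq ι] {U : Matrix m ι ℂ} (hU : Uᴴ * U = 1)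
    (x : m → ℂ) : ‖WithLp.toLp 2 (Uᴴ *ᵥ x)‖ ≤ ‖WithLp.toLp 2 x‖ := by
  classical
  -- The complementary projection is a Hermitian square, hence positive; its quadratic form at `x`
  -- is the difference of the two squared norms.
  have hM : (1 - U * Uᴴ)ᴴ * (1 - U * Uᴴ) = 1 - U * Uᴴ := by
    have h : U * Uᴴ * (U * Uᴴ) = U * Uᴴ := by
      rw [Matrix.mul_assoc, ← Matrix.mul_assoc Uᴴ, hU, Matrix.one_mul]
    simp [Matrix.mul_sub, Matrix.sub_mul, h]
  have h := (posSemidef_conjTranspose_mul_self (1 - U * Uᴴ)).dotProduct_mulVec_nonneg x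
  have hx : star (Uᴴ *ᵥ x) ⬝ᵥ (Uᴴ *ᵥ x) = star x ⬝ᵥ ((U * Uᴴ) *ᵥ x) := by
    rw [star_mulVec, conjTranspose_conjTranspose, ← mulVec_mulVec, ← dotProduct_mulVec]
  rw [hM, sub_mulVec, one_mulVec, dotProduct_sub, ← hx, ← norm_toLp_sq, ← norm_toLp_sq,
    sub_nonneg] at h
  exact (pow_le_pow_iff_left₀ (norm_nonneg _) (norm_nonneg _) two_ne_zero).1
    (by exact_mod_cast h)

/-- The columns of an isometry are unit vectors. -/
lemma norm_col_eq_one {κ : Type*} [DecidableEq κ] {U : Matrix m κ ℂ} (hU : Uᴴ * U = 1) (j : κ) :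
    ‖WithLp.toLp 2 (U.col j)‖ = 1 := by
  have h : ((‖WithLp.toLp 2 (U.col j)‖ ^ 2 : ℝ) : ℂ) = 1 := by
    rw [norm_toLp_sq]
    simpa [Matrix.mul_apply, dotProduct] using congrFun (congrFun hU j) j
  exact (pow_eq_one_iff_of_nonneg (norm_nonneg _) two_ne_zero).1 (by exact_mod_cast h)

lemma norm_toLp_star (y : m → ℂ) : ‖WithLp.toLp 2 (star y)‖ = ‖WithLp.toLp 2 y‖ := by
  simp [EuclideanSpace.norm_eq]

/-- The trace norm of a sum of matrices of rank one. -/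
lemma traceNorm_sum_vecMulVec_le [DecidableEq n] (x : ι → m → ℂ) (y : ι → n → ℂ) :
    traceNorm (∑ i, vecMulVec (x i) (y i)) ≤
      ∑ i, ‖WithLp.toLp 2 (x i)‖ * ‖WithLp.toLp 2 (y i)‖ := by
  classical
  obtain ⟨S, _, s, U, V, hs, hU, hV, hA⟩ := exists_svd (∑ i, vecMulVec (x i) (y i))
  -- Duality: pairing with the partial isometry `V * Uᴴ` reads off the trace norm, and this pairing
  -- is linear in the rank-one terms.
  have htr : (V * Uᴴ * (U * diagonal (fun j => (s j : ℂ)) * Vᴴ)).trace = ∑ j, (s j : ℂ) := by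
    have : V * Uᴴ * (U * diagonal (fun j => (s j : ℂ)) * Vᴴ) =
        V * (Uᴴ * U) * (diagonal (fun j => (s j : ℂ)) * Vᴴ) := by
      simp only [Matrix.mul_assoc]
    rw [this, hU, Matrix.mul_one, Matrix.trace_mul_comm, Matrix.mul_assoc, hV, Matrix.mul_one,
      trace_diagonal]
  have hterm : ∀ i, ‖(V * Uᴴ * vecMulVec (x i) (y i)).trace‖ ≤
      ‖WithLp.toLp 2 (x i)‖ * ‖WithLp.toLp 2 (y i)‖ := by
    intro i
    have h1 : (V * Uᴴ * vecMulVec (x i) (y i)).trace =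
        inner ℂ (WithLp.toLp 2 (Vᴴ *ᵥ star (y i))) (WithLp.toLp 2 (Uᴴ *ᵥ x i)) := by
      rw [EuclideanSpace.inner_toLp_toLp, mul_vecMulVec, trace_vecMulVec, star_mulVec,
        conjTranspose_conjTranspose, star_star, ← mulVec_mulVec, dotProduct_comm,
        dotProduct_mulVec, dotProduct_comm]
    rw [h1, mul_comm, ← norm_toLp_star (y i)]
    exact (norm_inner_le_norm _ _).trans (mul_le_mul (norm_conjTranspose_mulVec_le hV _)
      (norm_conjTranspose_mulVec_le hU _) (norm_nonneg _) (norm_nonneg _))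
  calc traceNorm (∑ i, vecMulVec (x i) (y i)) = ∑ j, s j := by
        rw [hA]; exact traceNorm_svd hU hV fun j => (hs j).le
    _ = ‖∑ j, (s j : ℂ)‖ := by
        rw [← Complex.ofReal_sum, Complex.norm_real, Real.norm_eq_abs,
          abs_of_nonneg (Finset.sum_nonneg fun j _ => (hs j).le)]
    _ = ‖∑ i, (V * Uᴴ * vecMulVec (x i) (y i)).trace‖ := by
        rw [← htr, ← hA, Matrix.mul_sum, trace_sum]
    _ ≤ _ := (norm_sum_le _ _).trans (Finset.sum_le_sum fun i _ => hterm i)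

/-- The trace norm is convex. -/
lemma traceNorm_sum_smul_le [DecidableEq n] {p : ι → ℝ} (hp : ∀ i, 0 ≤ p i)
    (A : ι → Matrix m n ℂ) :
    traceNorm (∑ i, (p i : ℂ) • A i) ≤ ∑ i, p i * traceNorm (A i) := by
  classical
  choose S hS s U V hs hU hV hA using fun i => exists_svd (A i)
  -- Expanding every `A i` into its singular vectors reduces convexity to the rank-one bound.
  have hdec : ∑ i, (p i : ℂ) • A i = ∑ q : (i : ι) × S i,
      vecMulVec (((p q.1 * s q.1 q.2 : ℝ) : ℂ) • (U q.1).col q.2) (star ((V q.1).col q.2)) := by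
    rw [Fintype.sum_sigma]
    refine Finset.sum_congr rfl fun i _ => ?_
    ext a b
    rw [Matrix.smul_apply, congrFun (congrFun (hA i) a) b, Matrix.sum_apply,
      Matrix.mul_apply (N := (V i)ᴴ), smul_eq_mul, Finset.mul_sum]
    refine Finset.sum_congr rfl fun j _ => ?_
    simp [mul_diagonal, vecMulVec_apply]
    ring
  rw [hdec]
  refine (traceNorm_sum_vecMulVec_le _ _).trans (le_of_eq ?_)
  rw [Fintype.sum_sigma]
  refine Finset.sum_congr rfl fun i _ => ?_
  have hi : traceNorm (A i) = ∑ j, s i j := by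
    rw [congrArg traceNorm (hA i), traceNorm_svd (hU i) (hV i) fun j => (hs i j).le]
  rw [hi, Finset.mul_sum]
  refine Finset.sum_congr rfl fun j _ => ?_
  rw [norm_toLp_star, norm_col_eq_one (hV i), WithLp.toLp_smul, norm_smul, norm_col_eq_one (hU i),
    Complex.norm_real, Real.norm_of_nonneg (mul_nonneg (hp i) (hs i j).le), mul_one, mul_one]

end TraceNorm

/-! ### Schmidt decomposition and the negativity of pure states. -/

section Bipartite

variable {dA dB : ℕ}

/-- A state has a decomposition into pure states, by the spectral theorem. -/
lemma IsState.exists_isPureDecomposition {ρ : BipartiteMatrix dA dB} (hρ : IsState ρ) :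
    ∃ (k : ℕ) (p : Fin k → ℝ) (φ : Fin k → BipartiteVector dA dB), IsPureDecomposition p φ ρ := by
  obtain ⟨hpos, htr⟩ := hρ
  let e := Fintype.equivFin (Fin dA × Fin dB)
  refine ⟨_, fun i => hpos.1.eigenvalues (e.symm i), fun i => hpos.1.eigenvectorBasis (e.symm i),
    fun i => hpos.eigenvalues_nonneg _, ?_, fun i => hpos.1.eigenvectorBasis.orthonormal.1 _, ?_⟩
  · rw [e.symm.sum_comp (fun j => hpos.1.eigenvalues j)]
    have := hpos.1.trace_eq_sum_eigenvalues
    rw [htr] at this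
    exact Complex.ofReal_injective (by rw [Complex.ofReal_sum]; exact this.symm)
  · rw [e.symm.sum_comp
      (fun j => (hpos.1.eigenvalues j : ℂ) • projector (hpos.1.eigenvectorBasis j))]
    have h := hpos.1.spectral_theorem
    rw [Unitary.conjStarAlgAut_apply] at h
    ext a b
    refine (congrFun (congrFun h a) b).trans ?_
    rw [Matrix.sum_apply, Matrix.mul_apply]
    refine Finset.sum_congr rfl fun j _ => ?_
    simp only [mul_diagonal, projector, vecMulVec_apply, IsHermitian.eigenvectorUnitary_apply,
      Matrix.smul_apply, star_apply, Function.comp_apply, smul_eq_mul, Complex.coe_algebraMap]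
    rw [mul_left_comm, mul_assoc]

/-- Singular value decomposition of the coefficient matrix of a vector (the Schmidt
decomposition), entrywise. -/
lemma exists_schmidt (φ : BipartiteVector dA dB) (hφ : ‖φ‖ = 1) :
    ∃ (S : Set (Fin dB)) (_ : Fintype S) (s : S → ℝ) (U : Matrix (Fin dA) S ℂ)
      (V : Matrix (Fin dB) S ℂ), (∀ j, 0 < s j) ∧ Uᴴ * U = 1 ∧ Vᴴ * V = 1 ∧
        (∑ j, s j ^ 2 = 1) ∧ ∀ i k, φ (i, k) = ∑ j, U i j * s j * star (V k j) := by
  classical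
  obtain ⟨S, hS, s, U, V, hs, hU, hV, hA⟩ := exists_svd (Matrix.of fun i k => φ (i, k))
  refine ⟨S, hS, s, U, V, hs, hU, hV, ?_, fun i k => ?_⟩
  -- The squared Frobenius norm of the coefficient matrix is both `‖φ‖ ^ 2` and the sum of the
  -- squared singular values.
  · have h := congrArg (fun M => (Mᴴ * M).trace) hA
    simp only at h
    rw [conjTranspose_mul_self_of_svd hU, Matrix.trace_mul_comm _ Vᴴ, ← Matrix.mul_assoc, hV,
      Matrix.one_mul, diagonal_mul_diagonal, trace_diagonal] at h
    have h2 : ((‖φ‖ ^ 2 : ℝ) : ℂ) =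
        ((Matrix.of fun i k => φ (i, k))ᴴ * (Matrix.of fun i k => φ (i, k))).trace := by
      rw [EuclideanSpace.norm_sq_eq, Fintype.sum_prod_type_right]
      simp [Matrix.trace, Matrix.mul_apply, Complex.conj_mul']
    rw [← h2, hφ] at h
    have h3 : (1 : ℝ) ^ 2 = ∑ j, s j * s j := by exact_mod_cast h
    simp only [pow_two] at h3 ⊢
    rw [← h3, one_mul]
  · have h := congrFun (congrFun hA i) k
    simpa [Matrix.mul_apply (N := Vᴴ), mul_diagonal] using h

/-- Transposing `B` exchanges the `B`-indices of ket and bra, which leaves a singular value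
decomposition with left vectors from `U ⊗ₖ V`, right vectors from `V ⊗ₖ U` with its row factors
swapped, and values `s j * s l`. -/
lemma traceNorm_partialTransposeB_of_schmidt {φ : BipartiteVector dA dB} {S : Type*} [Fintype S]
    [DecidableEq S] {s : S → ℝ} {U : Matrix (Fin dA) S ℂ} {V : Matrix (Fin dB) S ℂ}
    (hs : ∀ j, 0 < s j) (hU : Uᴴ * U = 1) (hV : Vᴴ * V = 1)
    (hφ : ∀ i k, φ (i, k) = ∑ j, U i j * s j * star (V k j)) :
    traceNorm (partialTransposeB (projector φ)) = (∑ j, s j) ^ 2 := by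
  have hL : (U ⊗ₖ V)ᴴ * (U ⊗ₖ V) = 1 := by
    rw [conjTranspose_kronecker, ← mul_kronecker_mul, hU, hV, one_kronecker_one]
  have hR : ((V ⊗ₖ U).submatrix (Equiv.prodComm _ _) id)ᴴ *
      (V ⊗ₖ U).submatrix (Equiv.prodComm (Fin dA) (Fin dB)) id = 1 := by
    rw [conjTranspose_submatrix, submatrix_mul_equiv, conjTranspose_kronecker,
      ← mul_kronecker_mul, hU, hV, one_kronecker_one, submatrix_id_id]
  have hT : partialTransposeB (projector φ) =
      (U ⊗ₖ V) * diagonal (fun q : S × S => ((s q.1 * s q.2 : ℝ) : ℂ)) *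
        ((V ⊗ₖ U).submatrix (Equiv.prodComm (Fin dA) (Fin dB)) id)ᴴ := by
    ext ⟨i, k⟩ ⟨i', k'⟩
    rw [Matrix.mul_apply, Fintype.sum_prod_type]
    simp only [partialTransposeB, projector, of_apply, vecMulVec_apply, hφ, star_sum,
      Finset.sum_mul_sum, mul_diagonal]
    refine Finset.sum_congr rfl fun j _ => Finset.sum_congr rfl fun l _ => ?_
    simp
    ring
  rw [hT, traceNorm_svd hL hR fun q => (mul_pos (hs q.1) (hs q.2)).le, Fintype.sum_prod_type,
    pow_two, Finset.sum_mul_sum]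

/-! ### Rank-one expansion and affinity of the block matrix. -/

section Blocks

variable {n m : ℕ} (μ : EuclideanSpace ℝ (Fin n)) (ν : EuclideanSpace ℝ (Fin m))

/-- The block vector whose upper part is `μ` (on the diagonal `j = l`) and whose lower part is
the vectorization of `|u_j⟩⟨u_l|`. -/
noncomputable def blockVec {d : ℕ} {S : Type*} [DecidableEq S] (U : Matrix (Fin d) S ℂ)
    (q : S × S) : Fin n ⊕ Fin d × Fin d → ℂ :=
  Sum.elim (if q.1 = q.2 then complexify μ else 0) (fun x => star (U x.1 q.2) * U x.2 q.1)

lemma norm_blockVec {d : ℕ} {S : Type*} [Fintype S] [DecidableEq S] {U : Matrix (Fin d) S ℂ}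
    (hU : Uᴴ * U = 1) (q : S × S) :
    ‖WithLp.toLp 2 (blockVec μ U q)‖ = if q.1 = q.2 then √(‖μ‖ ^ 2 + 1) else 1 := by
  have hcol : ∀ j, ∑ i, ‖U i j‖ ^ 2 = 1 := by
    intro j
    have h := norm_col_eq_one hU j
    rw [EuclideanSpace.norm_eq, Real.sqrt_eq_one] at h
    exact h
  have hlow : ∑ x : Fin d × Fin d, ‖star (U x.1 q.2) * U x.2 q.1‖ ^ 2 = 1 := by
    rw [Fintype.sum_prod_type]
    simp only [norm_mul, norm_star, mul_pow]
    rw [← Finset.sum_mul_sum, hcol, hcol, one_mul]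
  rw [EuclideanSpace.norm_eq, Fintype.sum_sum_type]
  simp only [blockVec, Sum.elim_inl, Sum.elim_inr, hlow]
  split_ifs with h
  · rw [EuclideanSpace.norm_sq_eq]
    simp [complexify]
  · simp

/-- The block matrix of a pure state as a sum of matrices of rank one. -/
lemma Q_projector_of_schmidt {φ : BipartiteVector dA dB} {S : Type*} [Fintype S]
    [DecidableEq S] {s : S → ℝ} {U : Matrix (Fin dA) S ℂ} {V : Matrix (Fin dB) S ℂ}
    (hU : Uᴴ * U = 1) (hV : Vᴴ * V = 1) (hs1 : ∑ j, s j ^ 2 = 1)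
    (hφ : ∀ i k, φ (i, k) = ∑ j, U i j * s j * star (V k j)) :
    Q μ ν (projector φ) = ∑ q : S × S, vecMulVec (((s q.1 * s q.2 : ℝ) : ℂ) • blockVec μ U q)
      (blockVec ν (V.map star) q) := by
  have hU' : ∀ j l, ∑ i, U i j * star (U i l) = if j = l then 1 else 0 := by
    intro j l
    have h := congrFun (congrFun hU l) j
    simpa [Matrix.mul_apply, Matrix.one_apply, mul_comm, eq_comm] using h
  have hV' : ∀ j l, ∑ k, star (V k j) * V k l = if j = l then 1 else 0 := by
    intro j l
    have h := congrFun (congrFun hV j) l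
    simpa [Matrix.mul_apply, Matrix.one_apply] using h
  have hite : ∀ {d : ℕ} (x : Fin d → ℂ) (j l : S) (a : Fin d),
      (if j = l then x else 0) a = if j = l then x a else 0 := fun x j l a => by
    rw [ite_apply, Pi.zero_apply]
  -- Orthonormality on the traced-out side kills the pairs `j ≠ l`. This is why `blockVec` carries
  -- `μ` only on the diagonal.
  have hA : ∀ i i', reducedA (projector φ) i i' =
      ∑ j, ((s j : ℂ) * s j) * (star (U i' j) * U i j) := by
    intro i i'
    simp only [reducedA, projector, of_apply, vecMulVec_apply, hφ, star_sum, Finset.sum_mul_sum]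
    rw [Finset.sum_comm]
    refine Finset.sum_congr rfl fun j _ => ?_
    rw [Finset.sum_comm]
    have h : ∀ l, ∑ k, U i j * s j * star (V k j) * star (U i' l * s l * star (V k l)) =
        (U i j * s j * (star (U i' l) * s l)) * (if j = l then 1 else 0) := by
      intro l
      rw [← hV', Finset.mul_sum]
      refine Finset.sum_congr rfl fun k _ => ?_
      simp
      ring
    simp only [h, mul_ite, mul_one, mul_zero, Finset.sum_ite_eq, Finset.mem_univ, if_true]
    ring
  have hB : ∀ k k', reducedB (projector φ) k k' =
      ∑ j, ((s j : ℂ) * s j) * (V k' j * star (V k j)) := by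
    intro k k'
    simp only [reducedB, projector, of_apply, vecMulVec_apply, hφ, star_sum, Finset.sum_mul_sum]
    rw [Finset.sum_comm]
    refine Finset.sum_congr rfl fun j _ => ?_
    rw [Finset.sum_comm]
    have h : ∀ l, ∑ i, U i j * s j * star (V k j) * star (U i l * s l * star (V k' l)) =
        (s j * star (V k j) * (s l * V k' l)) * (if j = l then 1 else 0) := by
      intro l
      rw [← hU', Finset.mul_sum]
      refine Finset.sum_congr rfl fun i _ => ?_
      simp
      ring
    simp only [h, mul_ite, mul_one, mul_zero, Finset.sum_ite_eq, Finset.mem_univ, if_true]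
    ring
  have hs1' : ∑ j, (s j : ℂ) * s j = 1 := by
    simp only [← pow_two]
    exact_mod_cast hs1
  ext a b
  rw [Matrix.sum_apply, Fintype.sum_prod_type]
  simp only [vecMulVec_apply, Pi.smul_apply, smul_eq_mul]
  rcases a with a | ⟨i', i⟩ <;> rcases b with b | ⟨k', k⟩
  · simp only [Q, blockVec, fromBlocks_apply₁₁, vecMulVec_apply, Sum.elim_inl, hite, mul_ite, ite_mul,
      mul_zero, zero_mul, Finset.sum_ite_eq, Finset.mem_univ, if_true, Complex.ofReal_mul]
    rw [← Finset.sum_mul, ← Finset.sum_mul, hs1', one_mul]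
  · simp only [Q, blockVec, fromBlocks_apply₁₂, vecMulVec_apply, Sum.elim_inl, Sum.elim_inr, vec,
      hB, hite, Finset.mul_sum, mul_ite, ite_mul, mul_zero, zero_mul, Finset.sum_ite_eq,
      Finset.mem_univ, if_true, Complex.ofReal_mul, star_star, map_apply]
    refine Finset.sum_congr rfl fun j _ => ?_
    ring
  · simp only [Q, blockVec, fromBlocks_apply₂₁, vecMulVec_apply, Sum.elim_inl, Sum.elim_inr, vec,
      hA, hite, Finset.sum_mul, mul_ite, mul_zero, Finset.sum_ite_eq,
      Finset.mem_univ, if_true, Complex.ofReal_mul]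
  · simp only [Q, blockVec, fromBlocks_apply₂₂, realign, block, of_apply, vec, projector,
      vecMulVec_apply, hφ, star_sum, Finset.sum_mul_sum, Sum.elim_inr]
    refine Finset.sum_congr rfl fun j _ => Finset.sum_congr rfl fun l _ => ?_
    simp
    ring

/-- The bound for pure states. -/
lemma traceNorm_Q_projector_le {φ : BipartiteVector dA dB} (hφ : ‖φ‖ = 1) :
    traceNorm (Q μ ν (projector φ)) ≤ traceNorm (partialTransposeB (projector φ)) - 1 +
      √((‖μ‖ ^ 2 + 1) * (‖ν‖ ^ 2 + 1)) := by
  classical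
  obtain ⟨S, _, s, U, V, hs, hU, hV, hs1, hφ'⟩ := exists_schmidt φ hφ
  have hVs : (V.map star)ᴴ * V.map star = 1 := by
    ext j l
    have h := congrFun (congrFun hV l) j
    simpa [Matrix.mul_apply, Matrix.one_apply, mul_comm, eq_comm] using h
  rw [traceNorm_partialTransposeB_of_schmidt hs hU hV hφ',
    Q_projector_of_schmidt μ ν hU hV hs1 hφ', Real.sqrt_mul (by positivity)]
  refine (traceNorm_sum_vecMulVec_le _ _).trans (le_of_eq ?_)
  set a := √(‖μ‖ ^ 2 + 1)
  set b := √(‖ν‖ ^ 2 + 1)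
  -- A product `s j * s l` for every pair sums to `(∑ s j) ^ 2`; the diagonal excess sums to `a * b
  -- - 1`.
  have hterm : ∀ q : S × S, ‖WithLp.toLp 2 (((s q.1 * s q.2 : ℝ) : ℂ) • blockVec μ U q)‖ *
      ‖WithLp.toLp 2 (blockVec ν (V.map star) q)‖ =
      s q.1 * s q.2 + if q.1 = q.2 then s q.1 * s q.2 * (a * b - 1) else 0 := by
    intro q
    rw [WithLp.toLp_smul, norm_smul, Complex.norm_real,
      Real.norm_of_nonneg (mul_pos (hs q.1) (hs q.2)).le, norm_blockVec μ hU, norm_blockVec ν hVs]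
    split_ifs <;> ring
  rw [Finset.sum_congr rfl fun q _ => hterm q, Fintype.sum_prod_type]
  simp only [Finset.sum_add_distrib, Finset.sum_ite_eq, Finset.mem_univ, if_true]
  rw [← Finset.sum_mul_sum, ← Finset.sum_mul]
  simp only [← pow_two, hs1]
  ring

/-- The block matrix is affine in the state. -/
lemma Q_sum_smul {k : ℕ} {p : Fin k → ℝ} (hp : ∑ i, p i = 1) (σ : Fin k → BipartiteMatrix dA dB) :
    Q μ ν (∑ i, (p i : ℂ) • σ i) = ∑ i, (p i : ℂ) • Q μ ν (σ i) := by
  have hp' : ∑ i, (p i : ℂ) = 1 := by exact_mod_cast hp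
  have hA : (reducedA (∑ i, (p i : ℂ) • σ i)) = ∑ i, (p i : ℂ) • reducedA (σ i) := by
    ext a b
    simp only [reducedA, of_apply, Matrix.sum_apply, Matrix.smul_apply, smul_eq_mul, Finset.mul_sum]
    exact Finset.sum_comm
  have hB : (reducedB (∑ i, (p i : ℂ) • σ i)) = ∑ i, (p i : ℂ) • reducedB (σ i) := by
    ext a b
    simp only [reducedB, of_apply, Matrix.sum_apply, Matrix.smul_apply, smul_eq_mul, Finset.mul_sum]
    exact Finset.sum_comm
  ext a b
  rw [Matrix.sum_apply]
  rcases a with a | a <;> rcases b with b | b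
  · simp [Q, ← Finset.sum_mul, hp']
  · simp only [Q, hA, hB, fromBlocks_apply₁₂, vecMulVec_apply, vec, Matrix.sum_apply,
      Matrix.smul_apply, smul_eq_mul, Finset.mul_sum]
    exact Finset.sum_congr rfl fun i _ => by ring
  · simp only [Q, hA, hB, fromBlocks_apply₂₁, vecMulVec_apply, vec, Matrix.sum_apply,
      Matrix.smul_apply, smul_eq_mul, Finset.sum_mul]
    exact Finset.sum_congr rfl fun i _ => by ring
  · obtain ⟨_, _⟩ := b
    simp [Q, realign, block, flip, Matrix.sum_apply]

end Blocks

end Bipartite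

end Realign

theorem theorem3 (dA dB : ℕ) (hd : 2 ≤ min dA dB) (n m : ℕ)
    (μ : EuclideanSpace ℝ (Fin n)) (ν : EuclideanSpace ℝ (Fin m))
    (ρ : Realign.BipartiteMatrix dA dB) (hρ : Realign.IsState ρ) :
    Realign.cren ρ ≥
      (Realign.traceNorm (Realign.Q μ ν ρ) - Real.sqrt ((‖μ‖ ^ 2 + 1) * (‖ν‖ ^ 2 + 1))) /
        (((min dA dB : ℕ) : ℝ) - 1) := by
  have hd' : (0 : ℝ) ≤ ((min dA dB : ℕ) : ℝ) - 1 := by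
    have : (2 : ℝ) ≤ ((min dA dB : ℕ) : ℝ) := by exact_mod_cast hd
    linarith
  -- Some decomposition must exist: the real `sInf` of the empty set is `0`, which need not dominate
  -- the bound.
  obtain ⟨k₀, p₀, φ₀, h₀⟩ := hρ.exists_isPureDecomposition
  refine le_csInf ⟨_, k₀, p₀, φ₀, h₀, rfl⟩ ?_
  rintro x ⟨k, p, φ, ⟨hp, hp1, hφ, hdec⟩, rfl⟩
  have hpure : ∑ i, p i * Realign.pureNegativity (φ i) =
      (∑ i, p i * (Realign.traceNorm (Realign.partialTransposeB (Realign.projector (φ i))) - 1)) /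
        (((min dA dB : ℕ) : ℝ) - 1) := by
    rw [Finset.sum_div]
    exact Finset.sum_congr rfl fun i _ => (mul_div_assoc _ _ _).symm
  rw [hpure]
  refine div_le_div_of_nonneg_right ?_ hd'
  rw [hdec, Realign.Q_sum_smul μ ν hp1, sub_le_iff_le_add]
  refine (Realign.traceNorm_sum_smul_le hp _).trans ?_
  refine (Finset.sum_le_sum fun i _ => mul_le_mul_of_nonneg_left
    (Realign.traceNorm_Q_projector_le μ ν (hφ i)) (hp i)).trans (le_of_eq ?_)
  simp only [mul_add (p _), Finset.sum_add_distrib]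
  rw [← Finset.sum_mul, hp1, one_mul]
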